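/- All graphs are finite and simple. For a graph $G$, let $\rho(G)$ denote its spectral radius, i.e. the largest eigenvalue of its adjacency matrix, and let $c(G)$ denote the number of connected components of $G$. The graph $G$ is *1-tough* if $|S|\ge c(G-S)$ for every set $S\subseteq V(G)$ with $c(G-S)>1$. Write $K_m$ for the complete graph on $m$ vertices, $\cup$ for disjoint union, $\delta K_1$ for the graph consisting of $\delta$ isolated vertices, and $\nabla$ for the join (disjoint union together with all edges between the two graphs). **Theorem 1.1.** Let $G$ be a connected graph of order $n$ with minimum degree $\delta\ge 2$, and suppose that $n\ge\max\{5\delta,\ \tfrac25\delta^2+\delta\}$. If $$\rho(G)\ \ge\ \rho\bigl(K_\delta\nabla(K_{n-2\delta}\cup\delta K_1)\bigr),$$ then $G$ is 1-tough, unless $G\cong K_\delta\nabla(K_{n-2\delta}\cup\delta K_1)$. -/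

import Mathlib

namespace SimpleGraph

/-- The spectral radius `ρ(G)`: the largest eigenvalue of the adjacency matrix of a finite graph
(a maximum when there is at least one vertex, see `isGreatest_adjSpectralRadius`). -/
noncomputable def adjSpectralRadius {V : Type*} [Fintype V] (G : SimpleGraph V) : ℝ :=
  open Classical in sSup (spectrum ℝ (G.adjMatrix ℝ))

open Classical in
theorem isGreatest_adjSpectralRadius {V : Type*} [Fintype V] [Nonempty V] (G : SimpleGraph V) :
    IsGreatest (spectrum ℝ (G.adjMatrix ℝ)) G.adjSpectralRadius := by
  have hA : (G.adjMatrix ℝ).IsHermitian := by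
    rw [Matrix.IsHermitian, Matrix.conjTranspose_eq_transpose_of_trivial]
    exact G.isSymm_adjMatrix
  have hs := hA.spectrum_real_eq_range_eigenvalues
  have hfin : (spectrum ℝ (G.adjMatrix ℝ)).Finite := by
    rw [hs]
    exact Set.finite_range _
  have hne : (spectrum ℝ (G.adjMatrix ℝ)).Nonempty := by
    rw [hs]
    exact Set.range_nonempty _
  exact ⟨hne.csSup_mem hfin, fun x hx => le_csSup hfin.bddAbove hx⟩

/-- `c(G)`: the number of connected components of `G`. -/
noncomputable def numComponents {V : Type*} (G : SimpleGraph V) : ℕ :=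
  Nat.card G.ConnectedComponent

/-- A finite graph `G` is `t`-tough if `|S| ≥ t · c(G - S)` for every vertex subset `S`
with `c(G - S) > 1`. -/
def IsTough {V : Type*} [Fintype V] (G : SimpleGraph V) (t : ℝ) : Prop :=
  ∀ S : Finset V, 1 < (G.induce ((S : Set V)ᶜ)).numComponents →
    t * ((G.induce ((S : Set V)ᶜ)).numComponents : ℝ) ≤ (S.card : ℝ)

/-- The join `G ∇ H`: the disjoint union of `G` and `H` together with all edges between them. -/
def joinGraph {V W : Type*} (G : SimpleGraph V) (H : SimpleGraph W) : SimpleGraph (V ⊕ W) :=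
  (G ⊕g H) ⊔ completeBipartiteGraph V W

/-- The graph `K_δ ∇ (K_{n-2δ} ∪ δ K_1)`, which has `n` vertices when `2 δ ≤ n`. -/
def toughExtremal (n δ : ℕ) : SimpleGraph (Fin δ ⊕ (Fin (n - 2 * δ) ⊕ Fin δ)) :=
  joinGraph (completeGraph (Fin δ)) (completeGraph (Fin (n - 2 * δ)) ⊕g emptyGraph (Fin δ))

end SimpleGraph

namespace SimpleGraph

open Finset Matrix

/-! If G is not 1-tough, some S with |S| = s leaves more than s components. Then G lies inside a
clique on S joined to disjoint cliques of sizes `N a`. Put 1 on S and s/(t - `N a`) on part a: on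
the parts this satisfies the eigenvalue equation of the larger graph for t - 1, and on S it is a
supersolution exactly when s·∑ `N a`/(t - `N a`) ≤ t - s. In that case ρ(G) ≤ t - 1, with equality
only if G is the whole larger graph (`Connected.rigidity_of_separation`).

Take for t a root of the extremal graph's equation with n - δ < t < n, so that t - 1 ≤ ρ(G).
Convexity of x/(t - x) (`sum_div_sub_le`) reduces the condition to s parts of minimal size k and one
large part, where k = 1 if s ≥ δ and k = δ + 1 - s if s < δ. The inequality is strict for s ≠ δ, a
contradiction; for s = δ it is an equality, and rigidity returns the extremal graph. -/

/-! ### Comparison with a positive supersolution -/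

/-- A positive supersolution `x` of `A x ≤ l x` on a connected graph with an eigenvalue at
least `l` is an eigenvector. -/
theorem Connected.sum_adj_eq_of_supersolution {V : Type*} [Fintype V] {G : SimpleGraph V}
    [DecidableRel G.Adj] (hG : G.Connected) {x z : V → ℝ} (hx : ∀ v, 0 < x v) {l μ : ℝ}
    (hsup : ∀ v, ∑ u, G.adjMatrix ℝ v u * x u ≤ l * x v)
    (hz : G.adjMatrix ℝ *ᵥ z = μ • z) (hz0 : z ≠ 0) (hμ : l ≤ μ) (v : V) :
    ∑ u, G.adjMatrix ℝ v u * x u = l * x v := by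
  set A := G.adjMatrix ℝ with hA
  have hsymm : ∀ u v, A u v = A v u := fun u v => by simp [hA, adjMatrix_apply, G.adj_comm]
  have hA0 : ∀ u v, 0 ≤ A u v := fun u v => by
    simp only [hA, adjMatrix_apply]; split_ifs <;> norm_num
  obtain ⟨w, hw⟩ : ∃ w : V → ℝ, ∀ v, z v = w v * x v :=
    ⟨fun v => z v / x v, fun v => by field_simp [(hx v).ne']⟩
  have hz' : ∀ v, ∑ u, A v u * z u = μ * z v := fun v => by
    have := congrFun hz v
    simpa [mulVec, dotProduct] using this
  -- With z = w·x, let P and Q be the sums of the terms in `hP0` and `hQ0`. Then P + 2Q = 2(l -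
  -- μ)∑z² ≤ 0, so both vanish: P = 0 makes w constant, and Q = 0 removes the slack.
  have hP0 : ∀ v u, 0 ≤ A v u * x u * x v * (w u - w v) ^ 2 := fun v u =>
    mul_nonneg (mul_nonneg (mul_nonneg (hA0 v u) (hx u).le) (hx v).le) (sq_nonneg _)
  have hQ0 : ∀ v, 0 ≤ w v ^ 2 * x v * (l * x v - ∑ u, A v u * x u) := fun v =>
    mul_nonneg (mul_nonneg (sq_nonneg _) (hx v).le) (sub_nonneg.2 (hsup v))
  have h1 : ∑ v, ∑ u, A v u * x u * x v * w v ^ 2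
      = ∑ v, w v ^ 2 * x v * ∑ u, A v u * x u := by
    refine sum_congr rfl fun v _ => ?_
    rw [mul_sum]; exact sum_congr rfl fun u _ => by ring
  have h2 : ∑ v, ∑ u, A v u * x u * x v * w u ^ 2
      = ∑ v, w v ^ 2 * x v * ∑ u, A v u * x u := by
    rw [← h1, sum_comm]
    refine sum_congr rfl fun v _ => sum_congr rfl fun u _ => ?_
    rw [hsymm u v]; ring
  have h3 : ∑ v, ∑ u, A v u * x u * x v * (w u * w v) = ∑ v, μ * z v ^ 2 := by
    refine sum_congr rfl fun v _ => ?_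
    have : μ * z v ^ 2 = z v * ∑ u, A v u * z u := by rw [hz']; ring
    rw [this, mul_sum]
    refine sum_congr rfl fun u _ => ?_
    rw [hw u, hw v]; ring
  have h4 : ∑ v, ∑ u, A v u * x u * x v * (w u - w v) ^ 2
      = 2 * (∑ v, w v ^ 2 * x v * ∑ u, A v u * x u) - 2 * ∑ v, μ * z v ^ 2 := by
    rw [two_mul, two_mul, ← h3]
    nth_rewrite 1 [← h1]
    rw [← h2]
    simp only [← sum_add_distrib, ← sum_sub_distrib]
    exact sum_congr rfl fun v _ => sum_congr rfl fun u _ => by ring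
  have h5 : ∑ v, w v ^ 2 * x v * (l * x v - ∑ u, A v u * x u)
      = ∑ v, l * z v ^ 2 - ∑ v, w v ^ 2 * x v * ∑ u, A v u * x u := by
    rw [← sum_sub_distrib]
    exact sum_congr rfl fun v _ => by rw [hw v]; ring
  have h6 : ∑ v, l * z v ^ 2 ≤ ∑ v, μ * z v ^ 2 :=
    sum_le_sum fun v _ => mul_le_mul_of_nonneg_right hμ (sq_nonneg _)
  have hP : 0 ≤ ∑ v, ∑ u, A v u * x u * x v * (w u - w v) ^ 2 :=
    sum_nonneg fun v _ => sum_nonneg fun u _ => hP0 v u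
  have hQ : 0 ≤ ∑ v, w v ^ 2 * x v * (l * x v - ∑ u, A v u * x u) :=
    sum_nonneg fun v _ => hQ0 v
  have hPz : ∑ v, ∑ u, A v u * x u * x v * (w u - w v) ^ 2 = 0 := by linarith
  have hQz : ∑ v, w v ^ 2 * x v * (l * x v - ∑ u, A v u * x u) = 0 := by linarith
  have hadj : ∀ u v, G.Adj u v → w u = w v := by
    intro u v huv
    have h := (sum_eq_zero_iff_of_nonneg fun v _ => sum_nonneg fun u _ => hP0 v u).1 hPz v
      (mem_univ _)
    have h := (sum_eq_zero_iff_of_nonneg fun u _ => hP0 v u).1 h u (mem_univ _)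
    have hA1 : A v u = 1 := by simp [hA, huv.symm]
    rw [hA1, one_mul] at h
    have h := (mul_eq_zero.1 h).resolve_left (mul_pos (hx u) (hx v)).ne'
    exact sub_eq_zero.1 (pow_eq_zero_iff two_ne_zero |>.1 h)
  have hconst : ∀ u v, w u = w v := by
    intro u v
    obtain ⟨p⟩ := hG.preconnected u v
    induction p with
    | nil => rfl
    | cons h _ ih => exact (hadj _ _ h).trans ih
  obtain ⟨v₀, hv₀⟩ := Function.ne_iff.1 hz0
  have hwv : w v ≠ 0 := by
    rw [hconst v v₀]
    intro h
    exact hv₀ (by simp [hw, h])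
  have h := (sum_eq_zero_iff_of_nonneg fun v _ => hQ0 v).1 hQz v (mem_univ _)
  have h := (mul_eq_zero.1 h).resolve_left (mul_pos (by positivity) (hx v)).ne'
  linarith

open Classical in
theorem exists_eigenvector_adjSpectralRadius {V : Type*} [Fintype V] [Nonempty V]
    (G : SimpleGraph V) :
    ∃ z : V → ℝ, z ≠ 0 ∧ G.adjMatrix ℝ *ᵥ z = G.adjSpectralRadius • z := by
  have h := G.isGreatest_adjSpectralRadius.1
  rw [← Matrix.spectrum_toLin', ← Module.End.hasEigenvalue_iff_mem_spectrum] at h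
  obtain ⟨z, hz⟩ := h.exists_hasEigenvector
  exact ⟨z, hz.2, by simpa using hz.apply_eq_smul⟩

open Classical in
theorem le_adjSpectralRadius_of_mulVec_eq {V : Type*} [Fintype V] (G : SimpleGraph V)
    {z : V → ℝ} {μ : ℝ} (hz0 : z ≠ 0) (hz : G.adjMatrix ℝ *ᵥ z = μ • z) :
    μ ≤ G.adjSpectralRadius := by
  obtain ⟨v, -⟩ := Function.ne_iff.1 hz0
  have : Nonempty V := ⟨v⟩
  refine G.isGreatest_adjSpectralRadius.2 ?_
  rw [← Matrix.spectrum_toLin', ← Module.End.hasEigenvalue_iff_mem_spectrum]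
  exact Module.End.hasEigenvalue_of_hasEigenvector (x := z)
    ⟨Module.End.mem_eigenspace_iff.2 (by simpa using hz), hz0⟩

/-- If `q` sends a separating set to `none` and labels the parts it separates, the spectral radius
is at most `t - 1` under a condition on the sizes of the parts; equality forces all edges
compatible with `q`. -/
theorem Connected.rigidity_of_separation {V K : Type*} [Fintype V] [Fintype K] [DecidableEq K]
    {G : SimpleGraph V} (hG : G.Connected) (q : V → Option K)
    (hq : ∀ u v, G.Adj u v → q u = none ∨ q v = none ∨ q u = q v)
    {s : ℕ} {N : K → ℕ} (hs : #{v | q v = none} = s) (hN : ∀ a, #{v | q v = some a} = N a)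
    (hs0 : 0 < s) {t : ℝ} (ht : ∀ a, (N a : ℝ) < t)
    (hsum : s * ∑ a, (N a : ℝ) / (t - N a) ≤ t - s) (hρ : t - 1 ≤ G.adjSpectralRadius) :
    s * ∑ a, (N a : ℝ) / (t - N a) = t - s ∧
      ∀ u v, G.Adj u v ↔ u ≠ v ∧ (q u = none ∨ q v = none ∨ q u = q v) := by
  classical
  have := hG.nonempty
  have hs0' : (0 : ℝ) < s := by exact_mod_cast hs0
  set y : Option K → ℝ := fun o => o.elim 1 fun a => s / (t - N a) with hy
  have hypos : ∀ o, 0 < y o := by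
    rintro (_ | a)
    · exact one_pos
    · exact div_pos hs0' (sub_pos.2 (ht a))
  have hya : ∀ a, s = (t - N a) * y (some a) := fun a => by
    have := (sub_pos.2 (ht a)).ne'
    simp only [hy, Option.elim]; field_simp
  -- sums over vertices are sums over labels
  have hfib : ∀ f : Option K → ℝ, ∑ v, f (q v) = s * f none + ∑ a, N a * f (some a) := by
    intro f
    rw [← sum_fiberwise_of_maps_to (s := univ) (t := univ) (g := q) (fun _ _ => mem_univ _),
      Fintype.sum_option]
    congr 1
    · rw [sum_congr rfl (g := fun _ => f none), sum_const, hs, nsmul_eq_mul]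
      intro v hv; rw [(mem_filter.1 hv).2]
    · refine sum_congr rfl fun a _ => ?_
      rw [sum_congr rfl (g := fun _ => f (some a)), sum_const, hN, nsmul_eq_mul]
      intro v hv; rw [(mem_filter.1 hv).2]
  let C : V → V → Prop := fun u v => q u = none ∨ q v = none ∨ q u = q v
  let B : V → V → ℝ := fun v u => if u ≠ v ∧ C v u then 1 else 0
  have hAB : ∀ v u, G.adjMatrix ℝ v u ≤ B v u := by
    intro v u
    by_cases h : G.Adj v u
    · have : u ≠ v ∧ C v u := ⟨h.ne', hq v u h⟩
      simp [B, h, this]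
    · simp only [adjMatrix_apply, h, if_false, B]
      split_ifs <;> norm_num
  have hB : ∀ v, ∑ u, B v u * y (q u) = ∑ u, (if C v u then y (q u) else 0) - y (q v) := by
    intro v
    rw [eq_sub_iff_add_eq]
    have : y (q v) = ∑ u, if u = v then y (q u) else 0 := by simp
    rw [this, ← sum_add_distrib]
    refine sum_congr rfl fun u _ => ?_
    by_cases h : u = v
    · subst h; simp [B, C]
    · simp [B, h]
  have hBle : ∀ v, ∑ u, B v u * y (q u) ≤ (t - 1) * y (q v) ∧
      (q v = none → ∑ u, B v u * y (q u) = s + s * ∑ a, (N a : ℝ) / (t - N a) - 1) := by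
    intro v
    rw [hB]
    obtain ⟨o, hv⟩ : ∃ o, q v = o := ⟨_, rfl⟩
    rcases o with _ | a
    · have h : ∑ u, (if C v u then y (q u) else 0) = s + s * ∑ a, (N a : ℝ) / (t - N a) := by
        have : ∀ u, (if C v u then y (q u) else 0) = y (q u) := fun u => by simp [C, hv]
        simp only [this]
        rw [hfib y, mul_sum]
        simp only [hy, Option.elim, mul_one]
        congr 1
        exact sum_congr rfl fun a _ => by ring
      rw [h, hv]
      simp only [hy, Option.elim]
      exact ⟨by linarith, fun _ => trivial⟩
    · have h : ∑ u, (if C v u then y (q u) else 0) = s + N a * y (some a) := by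
        refine (sum_congr rfl fun u _ => ?_).trans
          ((hfib fun o => if o = none ∨ some a = o then y o else 0).trans ?_)
        · simp [C, hv]
        · simp [hy]
      rw [h, hv]
      refine ⟨?_, by simp⟩
      have := hya a
      nlinarith
  obtain ⟨z, hz0, hz⟩ := G.exists_eigenvector_adjSpectralRadius
  have hAy : ∀ v, ∑ u, G.adjMatrix ℝ v u * y (q u) ≤ ∑ u, B v u * y (q u) := fun v =>
    sum_le_sum fun u _ => mul_le_mul_of_nonneg_right (hAB v u) (hypos _).le
  have heq := hG.sum_adj_eq_of_supersolution (x := fun v => y (q v)) (fun v => hypos _)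
    (fun v => (hAy v).trans (hBle v).1) hz hz0 hρ
  refine ⟨?_, fun u v => ⟨fun h => ⟨h.ne, hq u v h⟩, fun ⟨hne, hc⟩ => ?_⟩⟩
  · obtain ⟨v, hv⟩ := card_pos.1 (hs ▸ hs0)
    have hv := (mem_filter.1 hv).2
    have h1 := heq v
    have h2 := hAy v
    have h3 := (hBle v).2 hv
    simp only [hv] at h1
    simp only [hy, Option.elim] at h1 h2 h3
    linarith
  · have h1 : ∑ w, G.adjMatrix ℝ u w * y (q w) = ∑ w, B u w * y (q w) :=
      le_antisymm (hAy u) (by rw [heq u]; exact (hBle u).1)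
    have h2 := (sum_eq_sum_iff_of_le fun w _ =>
      mul_le_mul_of_nonneg_right (hAB u w) (hypos _).le).1 h1 v (mem_univ _)
    have h3 := mul_right_cancel₀ (hypos _).ne' h2
    have h4 : v ≠ u ∧ C u v := ⟨hne.symm, hc⟩
    by_contra hna
    simp [B, h4, hna] at h3

/-! ### The extremal graph and its equation -/

-- The vector constant on the three vertex classes is an eigenvector for t - 1: `h` is its equation
-- on the dominating clique, and the other two hold by the choice of values. A lower bound on the
-- radius suffices later, so t need not be the largest root.
open Classical in
theorem le_adjSpectralRadius_toughExtremal {n δ : ℕ} (hδ : 0 < δ) (hn : 2 * δ ≤ n) {t : ℝ}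
    (ht : 1 < t) (hm : (n : ℝ) - 2 * δ < t)
    (h : t - δ = δ * ((n - 2 * δ) / (t - (n - 2 * δ)) + δ * (1 / (t - 1)))) :
    t - 1 ≤ (toughExtremal n δ).adjSpectralRadius := by
  have h1 : t - 1 ≠ 0 := (sub_pos.2 ht).ne'
  have h2 : t - (n - 2 * δ) ≠ 0 := (sub_pos.2 hm).ne'
  have hcast : ((n - 2 * δ : ℕ) : ℝ) = n - 2 * δ := by push_cast [hn]; ring
  have hcompl : ∀ (k : ℕ) (i : Fin k) (c : ℝ), ∑ j, (if i = j then 0 else c) = k * c - c := by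
    intro k i c
    have : ∀ j, (if i = j then 0 else c) = c - if i = j then c else 0 := fun j => by
      split_ifs <;> simp
    simp [this, sum_sub_distrib]
  refine le_adjSpectralRadius_of_mulVec_eq _
    (z := Sum.elim (fun _ => 1) (Sum.elim (fun _ => δ / (t - (n - 2 * δ))) fun _ => δ / (t - 1)))
    (Function.ne_iff.2 ⟨Sum.inl ⟨0, hδ⟩, by simp⟩) ?_
  ext v
  simp only [mulVec, dotProduct, Fintype.sum_sum_type, Pi.smul_apply, adjMatrix_apply]
  rcases v with i | i | i
  · simp [toughExtremal, joinGraph, hcompl, hcast]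
    field_simp at h ⊢
    linarith
  · simp only [toughExtremal, joinGraph, sup_adj, sum_adj, completeBipartiteGraph_adj,
      completeGraph, emptyGraph, top_adj, Sum.elim_inl, Sum.elim_inr, smul_eq_mul]
    simp [hcompl, hcast]
    obtain ⟨u, hu⟩ : ∃ u, u = t - (n - 2 * δ : ℝ) := ⟨_, rfl⟩
    have hn' : (n : ℝ) - 2 * δ = t - u := by rw [hu]; ring
    rw [← hu] at h2 ⊢
    rw [hn']
    field_simp
    ring
  · simp [toughExtremal, joinGraph]
    field_simp

/-- Graphs whose adjacency is determined by equivalent colourings are isomorphic. -/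
theorem nonempty_iso_of_coloring {V W ι : Type*} [Fintype V] [Fintype W] [DecidableEq ι]
    {G : SimpleGraph V} {H : SimpleGraph W} (R : ι → ι → Prop) (c : V → ι) (d : W → ι)
    (hG : ∀ u v, G.Adj u v ↔ u ≠ v ∧ R (c u) (c v)) (hH : ∀ u v, H.Adj u v ↔ u ≠ v ∧ R (d u) (d v))
    (hcard : ∀ i, #{v | c v = i} = #{w | d w = i}) : Nonempty (G ≃g H) := by
  have he : ∀ i, Nonempty ({v // c v = i} ≃ {w // d w = i}) := fun i =>
    Fintype.card_eq.1 (by rw [Fintype.card_subtype, Fintype.card_subtype, hcard])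
  let e : V ≃ W := (Equiv.sigmaFiberEquiv c).symm.trans
    ((Equiv.sigmaCongrRight fun i => (he i).some).trans (Equiv.sigmaFiberEquiv d))
  have hde : ∀ v, d (e v) = c v := fun v => ((he (c v)).some ⟨v, rfl⟩).2
  exact ⟨⟨e, by intro u v; rw [hG, hH, hde, hde]; simp⟩⟩

/-- The equation for `ρ(K_δ ∇ (K_{n-2δ} ∪ δ K_1)) + 1` has a root between `n - δ` and `n`. -/
theorem exists_root_extremal {n d : ℝ} (hd : 2 ≤ d) (hn : 5 * d ≤ n) :
    ∃ t, n - d < t ∧ t < n ∧ d * t * (t - 1) + d ^ 2 * (t - n + 2 * d)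
      = t * (t - 1) * (t - n + 2 * d) := by
  set f : ℝ → ℝ := fun t => d * t * (t - 1) + d ^ 2 * (t - n + 2 * d)
      - t * (t - 1) * (t - n + 2 * d) with hf
  have hc : ContinuousOn f (Set.Icc (n - d) n) := by fun_prop
  have h0 : 0 < f (n - d) := by
    have : f (n - d) = d ^ 3 := by simp only [hf]; ring
    rw [this]; positivity
  have h1 : f n < 0 := by
    have : f n = d * (2 * d ^ 2 - n * (n - 1)) := by simp only [hf]; ring
    rw [this]
    exact mul_neg_of_pos_of_neg (by linarith) (by nlinarith)
  obtain ⟨t, ht, h⟩ := intermediate_value_Ioo' (by linarith) hc ⟨h1, h0⟩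
  exact ⟨t, ht.1, ht.2, by simp only [hf] at h; linarith⟩

/-! ### Estimates for the part sizes -/

/-- Convexity: `∑ N a / (t - N a)` over at least `s + 1` terms of size at least `k` is largest
when all but one term are `k`. -/
theorem sum_div_sub_le {K : Type*} [Fintype K] {N : K → ℝ} {s : ℕ} {k m t : ℝ} (hk : 0 < k)
    (hN : ∀ a, k ≤ N a) (hcard : s + 1 ≤ Fintype.card K) (hsum : ∑ a, N a = m + s * k)
    (hm : m < t) :
    (∀ a, N a ≤ m) ∧ ∑ a, N a / (t - N a) ≤ m / (t - m) + s * (k / (t - k)) ∧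
    (∑ a, N a / (t - N a) = m / (t - m) + s * (k / (t - k)) →
      Fintype.card K = s + 1 ∧ ∀ a, N a = k ∨ N a = m) := by
  classical
  have hcard' : (s : ℝ) + 1 ≤ Fintype.card K := by exact_mod_cast hcard
  have hNm : ∀ a, N a ≤ m := by
    intro a
    have h1 : ∑ b ∈ univ.erase a, k ≤ ∑ b ∈ univ.erase a, N b := sum_le_sum fun b _ => hN b
    have h2 := add_sum_erase univ N (mem_univ a)
    rw [sum_const, card_erase_of_mem (mem_univ a), card_univ, nsmul_eq_mul,
      Nat.cast_sub (by omega)] at h1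
    push_cast at h1
    nlinarith
  obtain ⟨a₀⟩ : Nonempty K := Fintype.card_pos_iff.1 (by omega)
  have hkt : k < t := (hN a₀).trans_lt ((hNm a₀).trans_lt hm)
  have htm := sub_pos.2 hm
  have htk := sub_pos.2 hkt
  -- Slope of the chord of x/(t - x) between k and m; `hchord` writes the function as chord minus a
  -- nonnegative defect.
  set σ := t / ((t - m) * (t - k)) with hσ
  have hchord : ∀ a, N a / (t - N a) = k / (t - k) + (N a - k) * σ
      - σ * (N a - k) * (m - N a) / (t - N a) := by
    intro a
    have : t - N a ≠ 0 := by linarith [hNm a]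
    have := htm.ne'
    have := htk.ne'
    rw [hσ]; field_simp; ring
  have hσ0 : 0 < σ := div_pos (by linarith) (by positivity)
  have hdef : ∀ a, 0 ≤ σ * (N a - k) * (m - N a) / (t - N a) := fun a =>
    div_nonneg (mul_nonneg (mul_nonneg hσ0.le (sub_nonneg.2 (hN a))) (sub_nonneg.2 (hNm a)))
      (by linarith [hNm a])
  have hm0 : 0 < m := hk.trans_le ((hN a₀).trans (hNm a₀))
  -- The loss caused by each part beyond the first s + 1.
  have hgap : 0 < k * σ - k / (t - k) := by
    have : k * σ - k / (t - k) = k * m / ((t - m) * (t - k)) := by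
      rw [hσ]; field_simp; ring
    rw [this]; positivity
  have hφm : m / (t - m) = k / (t - k) + (m - k) * σ := by
    rw [hσ]; field_simp; ring
  have htot : ∑ a, N a / (t - N a) = m / (t - m) + s * (k / (t - k))
      - (Fintype.card K - (s + 1)) * (k * σ - k / (t - k))
      - ∑ a, σ * (N a - k) * (m - N a) / (t - N a) := by
    rw [sum_congr rfl fun a _ => hchord a, sum_sub_distrib, sum_add_distrib, ← sum_mul,
      sum_sub_distrib, hsum, hφm]
    simp only [sum_const, card_univ, nsmul_eq_mul]
    ring
  have hA : 0 ≤ (Fintype.card K - ((s : ℝ) + 1)) * (k * σ - k / (t - k)) :=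
    mul_nonneg (sub_nonneg.2 hcard') hgap.le
  have hB := sum_nonneg fun a (_ : a ∈ univ) => hdef a
  refine ⟨hNm, by linarith, fun heq => ⟨?_, fun a => ?_⟩⟩
  · have h : (Fintype.card K - ((s : ℝ) + 1)) * (k * σ - k / (t - k)) = 0 := by linarith
    have h := (mul_eq_zero.1 h).resolve_right hgap.ne'
    have : (Fintype.card K : ℝ) = ((s + 1 : ℕ) : ℝ) := by push_cast; linarith
    exact_mod_cast this
  · have h : ∑ a, σ * (N a - k) * (m - N a) / (t - N a) = 0 := by linarith
    have h := (sum_eq_zero_iff_of_nonneg fun a _ => hdef a).1 h a (mem_univ a)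
    have hta : t - N a ≠ 0 := by linarith [hNm a]
    simp only [div_eq_zero_iff, mul_eq_zero, hσ0.ne', hta, sub_eq_zero, false_or, or_false] at h
    exact h.imp id Eq.symm

/-- After clearing denominators the claim is F(s) > 0 with F(s) = t(t-1)(t-n+s) - s²(t-n+2s). The
root equation says F(d) = 0, so it suffices that the factor (F(s) - F(d))/(s - d), bounded in `hB`,
is positive. -/
theorem separation_bound_large {n d s t : ℝ} (hd : 2 ≤ d) (hn : 5 * d ≤ n) (ht : n - d < t)
    (htn : t < n) (hroot : d * t * (t - 1) + d ^ 2 * (t - n + 2 * d)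
      = t * (t - 1) * (t - n + 2 * d)) (hs : d < s) (hsn : 2 * s + 1 ≤ n) :
    s * ((n - 2 * s) / (t - (n - 2 * s)) + s * (1 / (t - 1))) < t - s := by
  have h1 : 0 < t - 1 := by linarith
  have h2 : 0 < t - (n - 2 * s) := by linarith
  have hB : 0 < t * (t - 1) - (t - n) * (s + d) - 2 * (s ^ 2 + s * d + d ^ 2) := by
    -- `e1` replaces t by n - d, `e2` then replaces s by its maximum (n - 1)/2.
    have e1 : 0 < (t - (n - d)) * (t + (n - d) - 1 - (s + d)) :=
      mul_pos (by linarith) (by linarith)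
    have e2 : 0 ≤ ((n - 1) / 2 - s) * (d + 2 * s + (n - 1)) :=
      mul_nonneg (by linarith) (by linarith)
    have e3 : 0 ≤ n * (n - 5 * d) := mul_nonneg (by linarith) (by linarith)
    nlinarith
  have hC := mul_pos (sub_pos.2 hs) hB
  have : t - s - s * ((n - 2 * s) / (t - (n - 2 * s)) + s * (1 / (t - 1)))
      = (t * (t - 1) * (t - n + s) - s ^ 2 * (t - n + 2 * s)) / ((t - 1) * (t - (n - 2 * s))) := by
    obtain ⟨u, hu⟩ : ∃ u, u = t - (n - 2 * s) := ⟨_, rfl⟩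
    obtain rfl : n = t + 2 * s - u := by rw [hu]; ring
    have h3 : t - (t + 2 * s - u - 2 * s) = u := by ring
    have h1 := h1.ne'
    have h2 := h2.ne'
    rw [h3] at h2 ⊢
    field_simp; ring
  rw [← sub_pos, this]
  refine div_pos ?_ (by positivity)
  nlinarith

theorem separation_bound_small {n d s t : ℝ} (hd : 2 ≤ d) (hn : 5 * d ≤ n)
    (hn' : 2 / 5 * d ^ 2 + d ≤ n) (ht : n - d < t)
    (hroot : d * t * (t - 1) + d ^ 2 * (t - n + 2 * d)
      = t * (t - 1) * (t - n + 2 * d)) (hs : s = 1 ∨ 2 ≤ s) (hsd : s + 1 ≤ d) :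
    n - s - s * (d + 1 - s) < t ∧
    s * ((n - s - s * (d + 1 - s)) / (t - (n - s - s * (d + 1 - s)))
      + s * ((d + 1 - s) / (t - (d + 1 - s)))) < t - s := by
  obtain ⟨e, he⟩ : ∃ e, t = n - d + e := ⟨t - (n - d), by ring⟩
  have he0 : 0 < e := by linarith
  have hs1 : 1 ≤ s := by rcases hs with h | h <;> linarith
  have hD : t - (n - s - s * (d + 1 - s)) = e + s + (s - 1) * (d - s) := by rw [he]; ring
  have hDpos : 0 < e + s + (s - 1) * (d - s) := by
    have := mul_nonneg (sub_nonneg.2 hs1) (by linarith : 0 ≤ d - s)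
    linarith
  refine ⟨by linarith, ?_⟩
  have hk : 0 < t - (d + 1 - s) := by linarith
  have ht0 : 0 < t := by linarith
  -- The claim with denominators cleared. For s = 1 the right side is proportional to e, so the root
  -- equation is needed to bound e from below; for s ≥ 2 the terms with and without e are compared
  -- separately.
  have key : s ^ 2 * (d + 1 - s) * (e + s + (s - 1) * (d - s))
      < t * (t - (d + 1 - s)) * (e + (s - 1) * (d - s)) := by
    rcases hs with rfl | hs
    · have h1 : e * (t * (t - 1)) = d ^ 2 * (d + e) := by rw [he] at hroot ⊢; linarith
      have h2 : 0 < (d - 1) * (t - (d + 1)) := mul_pos (by linarith) (by linarith)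
      have h3 : (t - 1) * (1 + e) < d * (t - d) * (d + e) :=
        mul_lt_mul'' (by linarith) (by linarith) (by linarith) (by linarith)
      have h4 := mul_lt_mul_of_pos_left h3 (by linarith : 0 < d)
      have h5 : (t - 1) * (d * (e + 1)) < (t - 1) * (t * (t - d) * e) := by
        calc (t - 1) * (d * (e + 1)) = d * ((t - 1) * (1 + e)) := by ring
          _ < d * (d * (t - d) * (d + e)) := h4
          _ = (t - d) * (d ^ 2 * (d + e)) := by ring
          _ = (t - 1) * (t * (t - d) * e) := by rw [← h1]; ring
      have h6 := lt_of_mul_lt_mul_left h5 (by linarith)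
      ring_nf at h6 ⊢
      linarith
    · obtain ⟨j, hj⟩ : ∃ j, j = d - s := ⟨_, rfl⟩
      have hj1 : 1 ≤ j := by linarith
      have hk' : d + 1 - s = j + 1 := by linarith
      rw [hk', ← hj]
      have hd2 : 0 < d ^ 2 := by positivity
      have hsd2 : s ^ 2 ≤ d ^ 2 := by gcongr; linarith
      have hu : 3 * d < t - (j + 1) := by linarith
      have hT1 : 12 * d ^ 2 < t * (t - (j + 1)) := by
        have := mul_lt_mul'' (by linarith : 4 * d < t) hu (by linarith) (by linarith)
        linarith
      have hT2 : 6 / 5 * d ^ 3 < t * (t - (j + 1)) := by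
        have := mul_lt_mul'' (by linarith : 2 / 5 * d ^ 2 < t) hu (by positivity) (by linarith)
        linarith
      -- The 5 is what `h1` below needs. The quadratic lower bound on n enters only for j > 7 and d
      -- ≥ 15, where j + 5 ≤ d + 3 ≤ 6d/5.
      have hT : s ^ 2 * (j + 5) < t * (t - (j + 1)) := by
        rcases le_or_gt j 7 with h | h
        · refine lt_of_le_of_lt ?_ hT1
          nlinarith
        · rcases le_or_gt 15 d with h' | h'
          · refine lt_of_le_of_lt ?_ hT2
            calc s ^ 2 * (j + 5) ≤ d ^ 2 * (6 / 5 * d) :=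
                  mul_le_mul hsd2 (by linarith) (by linarith) (by positivity)
              _ = 6 / 5 * d ^ 3 := by ring
          · refine lt_of_le_of_lt ?_ hT1
            calc s ^ 2 * (j + 5) ≤ (8 / 15 * d) ^ 2 * 18 :=
                  mul_le_mul (by gcongr; linarith) (by linarith) (by linarith) (by positivity)
              _ ≤ 12 * d ^ 2 := by nlinarith
      have hP : s ^ 2 * (j + 1) < t * (t - (j + 1)) := by nlinarith
      have h1 : (j + 1) * (s + (s - 1) * j) ≤ (j + 5) * ((s - 1) * j) := by
        nlinarith [mul_nonneg (by linarith : 0 ≤ s - 1) (by linarith : 0 ≤ j - 1),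
          mul_nonneg (by linarith : 0 ≤ s - 2) (by linarith : 0 ≤ j + 1)]
      have h2 : 0 < (s - 1) * j := mul_pos (by linarith) (by linarith)
      have h3 := mul_le_mul_of_nonneg_left h1 (sq_nonneg s)
      have h4 := mul_lt_mul_of_pos_right hT h2
      have h5 := mul_lt_mul_of_pos_right hP he0
      linarith
  have : t - s - s * ((n - s - s * (d + 1 - s)) / (t - (n - s - s * (d + 1 - s)))
      + s * ((d + 1 - s) / (t - (d + 1 - s))))
      = (t * (t - (d + 1 - s)) * (e + (s - 1) * (d - s))
        - s ^ 2 * (d + 1 - s) * (e + s + (s - 1) * (d - s)))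
        / ((t - (d + 1 - s)) * (e + s + (s - 1) * (d - s))) := by
    rw [hD]
    have : n - s - s * (d + 1 - s) = t - (e + s + (s - 1) * (d - s)) := by rw [← hD]; ring
    rw [this]
    field_simp
    ring
  rw [← sub_pos, this]
  exact div_pos (by linarith) (by positivity)

/-! ### Recognising the extremal graph -/

theorem nonempty_iso_toughExtremal {V K : Type*} [Fintype V] [Fintype K] [DecidableEq K]
    {G : SimpleGraph V} {n δ : ℕ} (q : V → Option K) {N : K → ℕ} (hV : Fintype.card V = n)
    (hn : 2 * δ ≤ n) (hδ : #{v | q v = none} = δ) (hN : ∀ a, #{v | q v = some a} = N a)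
    (a₀ : K) (ha₀ : N a₀ = n - 2 * δ) (hN1 : ∀ a, a ≠ a₀ → N a = 1)
    (hG : ∀ u v, G.Adj u v ↔ u ≠ v ∧ (q u = none ∨ q v = none ∨ q u = q v)) :
    Nonempty (G ≃g toughExtremal n δ) := by
  classical
  let c : V → Fin 3 := fun v => if q v = none then 0 else if q v = some a₀ then 1 else 2
  let d : Fin δ ⊕ (Fin (n - 2 * δ) ⊕ Fin δ) → Fin 3 :=
    Sum.elim (fun _ => 0) (Sum.elim (fun _ => 1) fun _ => 2)
  have hc0 : #{v | c v = 0} = δ := by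
    rw [← hδ]; congr 1; ext v
    simp only [mem_filter, mem_univ, true_and, c]
    split_ifs <;> simp_all
  have hc1 : #{v | c v = 1} = n - 2 * δ := by
    rw [← ha₀, ← hN]; congr 1; ext v
    simp only [mem_filter, mem_univ, true_and, c]
    split_ifs <;> simp_all
  have hc2 : #{v | c v = 2} = δ := by
    have h := card_eq_sum_card_fiberwise (f := c) (s := univ) (t := univ) (by simp)
    rw [Fin.sum_univ_three, hc0, hc1, card_univ, hV] at h
    omega
  refine nonempty_iso_of_coloring (fun i j => i = 0 ∨ j = 0 ∨ i = 1 ∧ j = 1) c d ?_ ?_ ?_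
  · intro u v
    rw [hG]
    refine and_congr_right fun hne => ?_
    -- Merging all singleton parts into colour 2 loses nothing: distinct vertices never share one.
    have hinj : ∀ a, a ≠ a₀ → q u = some a → q v ≠ some a := by
      intro a ha hu hv
      obtain ⟨w, hw⟩ := card_eq_one.1 ((hN a).trans (hN1 a ha))
      have h1 : u ∈ ({w} : Finset V) := hw ▸ by simp [hu]
      have h2 : v ∈ ({w} : Finset V) := hw ▸ by simp [hv]
      exact hne ((mem_singleton.1 h1).trans (mem_singleton.1 h2).symm)
    rcases hu : q u with _ | a
    · simp [c, hu]
    · rcases hv : q v with _ | b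
      · simp [c, hv]
      · by_cases ha : a = a₀ <;> by_cases hb : b = a₀
        · simp [c, hu, hv, ha, hb]
        · simp [c, hu, hv, ha, hb, Ne.symm hb]
        · simp [c, hu, hv, ha, hb]
        · have : a ≠ b := fun h => hinj a ha hu (h ▸ hv)
          simp [c, hu, hv, ha, hb, this]
  · rintro (u | u | u) (v | v | v) <;> simp [toughExtremal, joinGraph, d]
  · intro i
    have hd : #{w | d w = i} = ![δ, n - 2 * δ, δ] i := by
      rw [card_filter, Fintype.sum_sum_type, Fintype.sum_sum_type]
      fin_cases i <;> simp [d]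
    rw [hd]
    fin_cases i
    · exact hc0
    · exact hc1
    · exact hc2

end SimpleGraph

/-! ### The main theorem -/

open SimpleGraph Finset in
theorem theorem1p1 {V : Type*} [Fintype V] (G : SimpleGraph V) [DecidableRel G.Adj] (n δ : ℕ)
    (hconn : G.Connected) (hcard : Fintype.card V = n) (hdeg : G.minDegree = δ) (hδ : 2 ≤ δ)
    (hn : max (5 * (δ : ℝ)) (2 / 5 * (δ : ℝ) ^ 2 + (δ : ℝ)) ≤ (n : ℝ))
    (hρ : (SimpleGraph.toughExtremal n δ).adjSpectralRadius ≤ G.adjSpectralRadius)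
    (hne : ¬ Nonempty (G ≃g SimpleGraph.toughExtremal n δ)) :
    G.IsTough 1 := by
  classical
  intro S hS
  by_contra hlt
  rw [one_mul, not_le, Nat.cast_lt] at hlt
  have hn1 : 5 * (δ : ℝ) ≤ n := (le_max_left _ _).trans hn
  have hn2 : 2 / 5 * (δ : ℝ) ^ 2 + δ ≤ n := (le_max_right _ _).trans hn
  have hnN : 5 * δ ≤ n := by exact_mod_cast hn1
  have hδR : (2 : ℝ) ≤ δ := by exact_mod_cast hδ
  let K := (G.induce ((S : Set V)ᶜ)).ConnectedComponent
  let _ : Fintype K := Fintype.ofFinite K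
  have hK : (G.induce ((S : Set V)ᶜ)).numComponents = Fintype.card K := Nat.card_eq_fintype_card
  rw [hK] at hS hlt
  let q : V → Option K := fun v =>
    if h : v ∈ S then none else some ((G.induce ((S : Set V)ᶜ)).connectedComponentMk ⟨v, by simpa⟩)
  have hqS : ∀ v, q v = none ↔ v ∈ S := fun v => by simp [q]
  have hqadj : ∀ u v, G.Adj u v → q u = none ∨ q v = none ∨ q u = q v := by
    intro u v huv
    by_cases hu : u ∈ S
    · exact Or.inl ((hqS u).2 hu)
    by_cases hv : v ∈ S
    · exact Or.inr (Or.inl ((hqS v).2 hv))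
    refine Or.inr (Or.inr ?_)
    simp only [q, hu, hv, dif_neg, not_false_eq_true, Option.some.injEq]
    exact ConnectedComponent.sound (Adj.reachable (by simpa using huv))
  have hqsurj : ∀ a, ∃ v, q v = some a := by
    intro a
    induction a using ConnectedComponent.ind with
    | h v =>
      have hv : v.1 ∉ S := fun h => v.2 (mem_coe.2 h)
      exact ⟨v.1, by simp [q, hv]⟩
  have hs : #{v | q v = none} = #S := by
    congr 1; ext v; simp [hqS]
  set s := #S with hsdef
  let N : K → ℕ := fun a => #{v | q v = some a}
  have htotal : s + ∑ a, N a = n := by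
    have h := card_eq_sum_card_fiberwise (f := q) (s := univ) (t := univ) (by simp)
    rw [Fintype.sum_option, hs, card_univ, hcard] at h
    exact h.symm
  have hN1 : ∀ a, 1 ≤ N a := fun a => by
    obtain ⟨v, hv⟩ := hqsurj a
    exact card_pos.2 ⟨v, by simp [hv]⟩
  have hNδ : ∀ a, δ + 1 ≤ s + N a := fun a => by
    obtain ⟨v, hv⟩ := hqsurj a
    -- A closed neighbourhood has at least δ + 1 vertices and stays in S and the component.
    have h1 : insert v (G.neighborFinset v) ⊆ S ∪ ({v | q v = some a} : Finset V) := by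
      intro u hu
      rw [mem_insert, mem_neighborFinset] at hu
      rcases hu with rfl | hu
      · simp [hv]
      · rcases hqadj v u hu with h | h | h
        · simp [hv] at h
        · simp [(hqS u).1 h]
        · simp [← h, hv]
    have h2 := card_le_card h1
    rw [card_insert_of_notMem (by simp), card_neighborFinset_eq_degree] at h2
    have h3 := G.minDegree_le_degree v
    have h4 := card_union_le S ({v | q v = some a} : Finset V)
    simp only [N]
    omega
  have hs0 : 0 < s := by
    rw [hsdef, card_pos, nonempty_iff_ne_empty]
    rintro rfl
    have h1 : (1 : ℕ) < Fintype.card K := hS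
    obtain ⟨a, b, hab⟩ := Fintype.one_lt_card_iff.1 h1
    obtain ⟨u, hu⟩ := hqsurj a
    obtain ⟨v, hv⟩ := hqsurj b
    obtain ⟨p⟩ := hconn.preconnected u v
    have : q u = q v := by
      clear hu hv
      induction p with
      | nil => rfl
      | cons h _ ih =>
        rcases hqadj _ _ h with h | h | h
        · simp [hqS] at h
        · simp [hqS] at h
        · exact h.trans ih
    rw [hu, hv] at this
    exact hab (Option.some.inj this)
  obtain ⟨t, ht1, ht2, hroot⟩ := exists_root_extremal hδR hn1
  have htρ : t - 1 ≤ G.adjSpectralRadius := by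
    refine le_trans (le_adjSpectralRadius_toughExtremal (by omega) (by omega) (by linarith)
      (by linarith) ?_) hρ
    have h1 : t - 1 ≠ 0 := by linarith
    have h2 : t - (n - 2 * δ) ≠ 0 := by linarith
    obtain ⟨u, hu⟩ : ∃ u, u = t - (n - 2 * δ : ℝ) := ⟨_, rfl⟩
    have hn' : (n : ℝ) - 2 * δ = t - u := by rw [hu]; ring
    have hu' : t - n + 2 * δ = u := by rw [hu]; ring
    rw [hu'] at hroot
    rw [← hu] at h2 ⊢
    rw [hn']
    field_simp
    linarith
  have htotalR : (s : ℝ) + ∑ a, (N a : ℝ) = n := by exact_mod_cast htotal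
  have hs0R : (0 : ℝ) < s := by exact_mod_cast hs0
  -- a bound on the size of the components gives a contradiction as soon as it is strict
  have main : ∀ k m : ℝ, 0 < k → (∀ a, k ≤ N a) → m = n - s - s * k → m < t →
      s * (m / (t - m) + s * (k / (t - k))) ≤ t - s →
      s * (m / (t - m) + s * (k / (t - k))) = t - s ∧
      (Fintype.card K = s + 1 ∧ ∀ a, (N a : ℝ) = k ∨ (N a : ℝ) = m) ∧
      ∀ u v, G.Adj u v ↔ u ≠ v ∧ (q u = none ∨ q v = none ∨ q u = q v) := by
    intro k m hk hkN hm hmt hb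
    obtain ⟨h1, h2, h3⟩ := sum_div_sub_le (N := fun a => (N a : ℝ)) hk hkN hlt
      (by linarith : ∑ a, (N a : ℝ) = m + s * k) hmt
    have h4 := mul_le_mul_of_nonneg_left h2 hs0R.le
    obtain ⟨h5, h6⟩ := hconn.rigidity_of_separation q hqadj hs (fun a => rfl) hs0
      (fun a => (h1 a).trans_lt hmt) (h4.trans hb) htρ
    have h7 : s * (m / (t - m) + s * (k / (t - k))) = t - s :=
      le_antisymm hb (by rw [← h5]; exact h4)
    exact ⟨h7, h3 (mul_left_cancel₀ hs0R.ne' (h5.trans h7.symm)), h6⟩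
  rcases lt_trichotomy s δ with hsδ | hsδ | hsδ
  · have hsδR : (s : ℝ) + 1 ≤ δ := by exact_mod_cast hsδ
    have hs12 : (s : ℝ) = 1 ∨ (2 : ℝ) ≤ s := by
      have : s = 1 ∨ 2 ≤ s := by omega
      exact_mod_cast this
    obtain ⟨h1, h2⟩ := separation_bound_small hδR hn1 hn2 ht1 hroot hs12 hsδR
    refine h2.ne (main _ _ (by linarith) (fun a => ?_) rfl h1 h2.le).1
    have : (δ : ℝ) + 1 ≤ s + N a := by exact_mod_cast hNδ a
    linarith
  · have hsR : (s : ℝ) = δ := by exact_mod_cast hsδ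
    have hb : s * ((n - 2 * s : ℝ) / (t - (n - 2 * s)) + s * (1 / (t - 1))) = t - s := by
      rw [hsR]
      have h1 : t - 1 ≠ 0 := by linarith
      have h2 : t - (n - 2 * δ) ≠ 0 := by linarith
      obtain ⟨u, hu⟩ : ∃ u, u = t - (n - 2 * δ : ℝ) := ⟨_, rfl⟩
      have hn' : (n : ℝ) - 2 * δ = t - u := by rw [hu]; ring
      have hu' : t - n + 2 * δ = u := by rw [hu]; ring
      rw [hu'] at hroot
      rw [← hu] at h2 ⊢
      rw [hn']
      field_simp
      linarith
    obtain ⟨-, ⟨hK', hNa⟩, hadj⟩ := main 1 (n - 2 * s) one_pos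
      (fun a => by exact_mod_cast hN1 a) (by ring) (by linarith) hb.le
    have hNa' : ∀ a, N a = 1 ∨ N a = n - 2 * δ := by
      intro a
      rcases hNa a with h | h
      · exact Or.inl (by exact_mod_cast h)
      · refine Or.inr ?_
        have : (N a : ℝ) = ((n - 2 * δ : ℕ) : ℝ) := by
          rw [h, hsR, Nat.cast_sub (by omega)]; push_cast; ring
        exact_mod_cast this
    obtain ⟨a₀, ha₀⟩ : ∃ a, N a ≠ 1 := by
      by_contra! h
      simp only [h, sum_const, card_univ, smul_eq_mul, hK'] at htotal
      omega
    refine hne (nonempty_iso_toughExtremal q hcard (by omega) (hs.trans hsδ) (fun a => rfl) a₀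
      ((hNa' a₀).resolve_left ha₀) (fun a ha => (hNa' a).resolve_right fun h => ?_) hadj)
    -- Two parts of size n - 2δ would exceed the n vertices, as n ≥ 5δ.
    have h1 : N a + ∑ b ∈ univ.erase a, N b = ∑ b, N b := add_sum_erase _ _ (mem_univ a)
    have h2 : N a₀ + ∑ b ∈ (univ.erase a).erase a₀, N b = ∑ b ∈ univ.erase a, N b :=
      add_sum_erase _ _ (mem_erase.2 ⟨ha.symm, mem_univ _⟩)
    have h3 : #((univ.erase a).erase a₀) • 1 ≤ ∑ b ∈ (univ.erase a).erase a₀, N b :=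
      card_nsmul_le_sum _ _ _ fun b _ => hN1 b
    rw [card_erase_of_mem (mem_erase.2 ⟨ha.symm, mem_univ _⟩), card_erase_of_mem (mem_univ a),
      card_univ, hK', smul_eq_mul, mul_one] at h3
    have h4 := (hNa' a₀).resolve_left ha₀
    omega
  · have hsδR : (δ : ℝ) < s := by exact_mod_cast hsδ
    have hsn : 2 * (s : ℝ) + 1 ≤ n := by
      have h1 : Fintype.card K • 1 ≤ ∑ a, N a := card_nsmul_le_sum _ _ _ fun a _ => hN1 a
      rw [smul_eq_mul, mul_one] at h1
      have : 2 * s + 1 ≤ n := by omega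
      exact_mod_cast this
    have hb := separation_bound_large hδR hn1 ht1 ht2 hroot hsδR hsn
    exact hb.ne (main 1 (n - 2 * s) one_pos (fun a => by exact_mod_cast hN1 a) (by ring)
      (by linarith) hb.le).1
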